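/- Let $\mathcal A$ be a collection of finite subsets of a set. For each $A\in\mathcal A$ let $\mathcal X_A$ be a nonempty countable set and $t_A:\mathcal X_A\to\mathbb R^d$ a statistic. Let $\Theta\subseteq\mathbb R^d$ be open, and suppose that $z_A(\theta)=\sum_{x\in\mathcal X_A}e^{\langle\theta,t_A(x)\rangle}<\infty$ for all $A\in\mathcal A$ and $\theta\in\Theta$. Let $\mathbb P_{A,\theta}$ be the probability distribution on $\mathcal X_A$ with density $p_{A,\theta}(x)=e^{\langle\theta,t_A(x)\rangle}/z_A(\theta)$ with respect to counting measure, let $T_A=t_A(X_A)$ with $X_A\sim\mathbb P_{A,\theta}$, and let $a_A=\log z_A$. Let $r_{|A|}$, $A\in\mathcal A$, be real scaling factors. All limits below are as $r_{|A|}\to\infty$. Suppose that there is a differentiable function $a:\Theta\to\mathbb R$ such that $$\lim_{r_{|A|}\to\infty}\frac{a_A(\theta')}{r_{|A|}}=a(\theta')\qquad\text{for all }\theta'\in\Theta .$$ If $\Theta\ne\mathbb R^d$, put $a=+\infty$ outside $\Theta$ and suppose also that $a$ is steep, that is, $\|\nabla a(\theta')\|\to\infty$ whenever $\theta'\in\Theta$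 tends to a boundary point of $\Theta$. (For $\Theta=\mathbb R^d$ this is no condition.) For $\theta\in\Theta$ let $$J(t)=\sup_{\phi\in\mathbb R^d}\ \langle\phi,t\rangle-[a(\theta+\phi)-a(\theta)].$$ Then, for every $\theta\in\Theta$: 1. For every measurable set $K\subseteq\mathbb R^d$ (indeed for every set $K\subseteq\mathbb R^d$), $$\liminf_{r_{|A|}\to\infty}\frac1{r_{|A|}}\log\mathbb P_{A,\theta}\Bigl(\frac{T_A}{r_{|A|}}\in K\Bigr)\ \ge\ -\inf_{t\in\operatorname{int}K}J(t),$$ $$\limsup_{r_{|A|}\to\infty}\frac1{r_{|A|}}\log\mathbb P_{A,\theta}\Bigl(\frac{T_A}{r_{|A|}}\in K\Bigr)\ \le\ -\inf_{t\in\operatorname{cl}K}J(t),$$ where $\log 0=-\infty$ and $\inf\emptyset=+\infty$. 2. $T_A/r_{|A|}$ converges in probability to $\nabla a(\theta)$: for every $\varepsilon>0$, $\mathbb P_{A,\theta}\bigl(\|T_A/r_{|A|}-\nabla a(\theta)\|\ge\varepsilon\bigr)\to0$. 3. If $\theta$ is identified by the limit, that is, $\nabla a(\theta')\neq\nabla a(\theta)$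 for all $\theta'\in\Theta$ with $\theta'\ne\theta$, then the maximum likelihood estimator converges in probability to $\theta$: for every $\varepsilon>0$, the $\mathbb P_{A,\theta}$-probability that the likelihood $\theta'\mapsto p_{A,\theta'}(X_A)$ has a maximizer over $\Theta$ and that every such maximizer lies within distance less than $\varepsilon$ of $\theta$ tends to $1$. -/

import Mathlib

open Filter Topology MeasureTheory
open scoped ENNReal RealInnerProductSpace

namespace ExpFam

noncomputable section

/-- The partition function `z(θ) = ∑ x, exp ⟪θ, t x⟫` of the statistic `t` on a countable
sample space. -/
def partitionFn {d : ℕ} {X : Type*} (t : X → EuclideanSpace ℝ (Fin d))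
    (θ : EuclideanSpace ℝ (Fin d)) : ℝ :=
  ∑' x, Real.exp ⟪θ, t x⟫

/-- The log-partition function `log z(θ)`. -/
def logPartition {d : ℕ} {X : Type*} (t : X → EuclideanSpace ℝ (Fin d))
    (θ : EuclideanSpace ℝ (Fin d)) : ℝ :=
  Real.log (partitionFn t θ)

/-- The density `exp ⟪θ, t x⟫ / z(θ)` of the exponential family with respect to counting
measure. -/
def density {d : ℕ} {X : Type*} (t : X → EuclideanSpace ℝ (Fin d))
    (θ : EuclideanSpace ℝ (Fin d)) (x : X) : ℝ :=
  Real.exp ⟪θ, t x⟫ / partitionFn t θ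

/-- The distribution on the sample space with parameter `θ`. -/
def law {d : ℕ} {X : Type*} [MeasurableSpace X] (t : X → EuclideanSpace ℝ (Fin d))
    (θ : EuclideanSpace ℝ (Fin d)) : Measure X :=
  Measure.count.withDensity fun x => ENNReal.ofReal (density t θ x)

/-- `θhat` is a maximum likelihood estimate over `Θ` from the observation `x`. -/
def IsMLE {d : ℕ} {X : Type*} (t : X → EuclideanSpace ℝ (Fin d))
    (Θ : Set (EuclideanSpace ℝ (Fin d))) (x : X) (θhat : EuclideanSpace ℝ (Fin d)) : Prop :=
  θhat ∈ Θ ∧ ∀ θ' ∈ Θ, density t θ' x ≤ density t θhat x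

/-- The rate function `J(t) = sup_φ ⟪φ, t⟫ - (a(θ + φ) - a(θ))`, where `a` is a function on `Θ`
and counts as `+∞` outside `Θ`; for `Θ = ℝ^d` the supremum is over all `φ`. -/
def rate {d : ℕ} (Θ : Set (EuclideanSpace ℝ (Fin d))) (a : EuclideanSpace ℝ (Fin d) → ℝ)
    (θ t : EuclideanSpace ℝ (Fin d)) : EReal :=
  ⨆ φ : EuclideanSpace ℝ (Fin d), ⨆ _ : θ + φ ∈ Θ,
    ((⟪φ, t⟫ - (a (θ + φ) - a θ) : ℝ) : EReal)

/-- `(1 / r) log p`, with value `-∞` at `p = 0` (for `r > 0`). -/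
def scaledLog (r : ℝ) (p : ℝ≥0∞) : EReal :=
  ((r⁻¹ : ℝ) : EReal) * ENNReal.log p

/-- The limit "as `r_A → ∞`" over an index set: a property holds eventually if it holds for all
`A` with `r A` large enough. -/
def scaleLimit {ι : Type*} (r : ι → ℝ) : Filter ι :=
  comap r atTop

/-- Steepness of `a` at the boundary of `Θ`; there is nothing to check for `Θ = ℝ^d`. -/
def IsSteep {d : ℕ} (Θ : Set (EuclideanSpace ℝ (Fin d)))
    (a : EuclideanSpace ℝ (Fin d) → ℝ) : Prop :=
  ∀ b ∈ frontier Θ, Tendsto (fun θ' => ‖gradient a θ'‖) (𝓝[Θ] b) atTop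

end

end ExpFam

/-!
Write `f_A = log z_A / r_A`. These functions are convex by Hölder's inequality and converge on `Θ`
to `a`.

*Convexity of `Θ`* is not assumed but forced (`convex_of_steep`). The `f_A` are finite and convex on
the convex hull of `Θ`, and locally bounded there, hence uniformly Lipschitz near a boundary point
of `Θ` that lies in the hull; this bounds `∇a` near that point and contradicts steepness. So `Θ` is
relatively closed in its hull, and `a` is a convex function on the convex set `Θ`.

*Upper bound* (`eventually_law_le`). A closed set on which the rate function exceeds `c` is covered
by finitely many half-spaces `{s | c + (a φ - a θ) ≤ ⟪φ - θ, s⟫}` with `φ ∈ Θ`: compactness handles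
the bounded part and a small sphere of increments around `θ` handles a neighbourhood of infinity.
The Chernoff bound shows that each half-space has probability about `exp (-r c)`. The law of large
numbers follows, since differentiability of `a` at `θ` bounds the rate function away from zero
outside a ball around `∇a(θ)`.

*Lower bound*. Under the tilted parameter `φ` the normalized statistic concentrates at `∇a(φ)`,
which gives the bound at `∇a(φ)` with the rate `⟪φ - θ, ∇a(φ)⟫ - (a φ - a θ)`
(`eventually_le_law`). An arbitrary point `s` of finite rate `j` is a limit of such gradients of no
larger rate (`exists_gradient_mem_nhds`): let `φ` minimize `a - ⟪·, s⟫ + (δ / 2) ‖· - θ‖²` over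
`Θ`, so that `∇a(φ) = s - δ (φ - θ)` and `‖δ (φ - θ)‖² ≤ 2 δ j`. Steepness is what makes the minimum
be attained (`exists_gradient_eq`): at the boundary the derivative towards `θ` is `-∞`.

*Maximum likelihood*. Pointwise convergence of convex functions is locally uniform
(`tendstoLocallyUniformlyOn_of_convexOn`). If `∇a(θ)` identifies `θ`, then `a - ⟪·, ∇a(θ)⟫` has its
strict minimum at `θ`, so when the normalized statistic is near `∇a(θ)` the negative log-likelihood
is larger on a small sphere around `θ` than at `θ`, and being convex it attains its minimum, inside
that sphere only.
-/

namespace ExpFam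

/-! ### Differentiable convex functions -/

section Convex

variable {E : Type*} [NormedAddCommGroup E] [InnerProductSpace ℝ E]

/-- A convex function lies above its tangent planes. -/
theorem add_inner_gradient_le [CompleteSpace E] {s : Set E} {f : E → ℝ} (hf : ConvexOn ℝ s f)
    {x y : E} (hx : x ∈ s) (hy : y ∈ s) (hd : DifferentiableAt ℝ f x) :
    f x + ⟪gradient f x, y - x⟫ ≤ f y := by
  have hc : ConvexOn ℝ (AffineMap.lineMap x y ⁻¹' s : Set ℝ)
      (f ∘ (AffineMap.lineMap x y : ℝ →ᵃ[ℝ] E)) := hf.comp_affineMap _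
  have hder : HasDerivAt (f ∘ (AffineMap.lineMap x y : ℝ →ᵃ[ℝ] E))
      ⟪gradient f x, y - x⟫ 0 := by
    have h1 : HasDerivAt (AffineMap.lineMap x y : ℝ →ᵃ[ℝ] E) (y - x) 0 :=
      AffineMap.hasDerivAt_lineMap
    have h2 : HasFDerivAt f (fderiv ℝ f x) ((AffineMap.lineMap x y : ℝ →ᵃ[ℝ] E) 0) := by
      simpa using hd.hasFDerivAt
    have h3 := h2.comp_hasDerivAt (0 : ℝ) h1
    rwa [← inner_gradient_left] at h3
  have h := hc.le_slope_of_hasDerivAt (x := 0) (y := 1) (by simpa using hx) (by simpa using hy)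
    one_pos hder
  simp only [slope_def_field, Function.comp_apply, AffineMap.lineMap_apply_one,
    AffineMap.lineMap_apply_zero, sub_zero, div_one] at h
  linarith

theorem gradient_eq_zero_of_isLocalMin [CompleteSpace E] {f : E → ℝ} {x v : E}
    (h : IsLocalMin f x) (hv : HasGradientAt f v x) : v = 0 := by
  have h0 := h.hasFDerivAt_eq_zero hv.hasFDerivAt
  simpa using h0

/-- A convex function bounded above by `M` on a ball and below by `m` at its centre is Lipschitz
on the ball of half the radius, with a constant that depends on `M`, `m` and the radius only. -/
theorem lipschitzOnWith_of_le_of_le {f : E → ℝ} {x₀ : E} {R M m : ℝ} (hR : 0 < R)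
    (hf : ConvexOn ℝ (Metric.ball x₀ R) f) (hM : ∀ x ∈ Metric.ball x₀ R, f x ≤ M)
    (hm : m ≤ f x₀) :
    LipschitzOnWith (2 * (|M| + 2 * |m|) / (R / 2)).toNNReal f (Metric.ball x₀ (R / 2)) := by
  have h := hf.lipschitzOnWith_of_abs_le (ε := R / 2) (M := |M| + 2 * |m|) (by positivity) ?_
  · rwa [show R - R / 2 = R / 2 by ring] at h
  intro x hx
  have hx' : x ∈ Metric.ball x₀ R := hx
  -- the reflection of `x` in the centre of the ball
  have hz : (2 : ℝ) • x₀ - x ∈ Metric.ball x₀ R := by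
    rw [Metric.mem_ball, dist_eq_norm] at hx' ⊢
    rwa [show (2 : ℝ) • x₀ - x - x₀ = -(x - x₀) by module, norm_neg]
  have hmid := hf.2 hx' hz (one_half_pos (α := ℝ)).le (one_half_pos (α := ℝ)).le (add_halves 1)
  rw [show (1 / 2 : ℝ) • x + (1 / 2 : ℝ) • ((2 : ℝ) • x₀ - x) = x₀ by module] at hmid
  simp only [smul_eq_mul] at hmid
  have h1 := hM x hx'
  have h2 := hM _ hz
  rw [abs_le]
  constructor <;> linarith [le_abs_self M, neg_abs_le m, le_abs_self m, abs_nonneg m]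

theorem exists_ball_eventually_le [FiniteDimensional ℝ E] {ι : Type*} {l : Filter ι} {C : Set E}
    {F : ι → E → ℝ} {y : E} (hC : C ∈ 𝓝 y) (hF : ∀ᶠ i in l, ConvexOn ℝ C (F i))
    (hM : ∀ p ∈ C, ∃ M, ∀ᶠ i in l, F i p ≤ M) :
    ∃ ρ > 0, ∃ M, Metric.ball y ρ ⊆ C ∧ ∀ᶠ i in l, ∀ x ∈ Metric.ball y ρ, F i x ≤ M := by
  obtain ⟨b, hyb, hbC⟩ := exists_mem_interior_convexHull_affineBasis hC
  have hb : ∀ k, b k ∈ C := fun k => hbC (subset_convexHull _ _ ⟨k, rfl⟩)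
  choose M hM' using fun k => hM (b k) (hb k)
  obtain ⟨ρ, hρ, hball⟩ := Metric.isOpen_iff.1 isOpen_interior y hyb
  refine ⟨ρ, hρ, Finset.univ.sup' Finset.univ_nonempty M,
    fun x hx => hbC (interior_subset (hball hx)), ?_⟩
  filter_upwards [hF, eventually_all.2 hM'] with i hi hi' x hx
  obtain ⟨_, ⟨k, rfl⟩, hk⟩ := (hi.subset hbC (convex_convexHull _ _)).exists_ge_of_mem_convexHull
    (subset_convexHull _ _) (interior_subset (hball hx))
  exact hk.trans ((hi' k).trans (Finset.le_sup' M (Finset.mem_univ k)))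

/-- Pointwise convergence of convex functions on an open set is locally uniform. -/
theorem tendstoLocallyUniformlyOn_of_convexOn [FiniteDimensional ℝ E] {ι : Type*} {l : Filter ι}
    {Θ : Set E} (hΘ : IsOpen Θ) {F : ι → E → ℝ} {a : E → ℝ}
    (hF : ∀ᶠ i in l, ConvexOn ℝ Θ (F i))
    (hlim : ∀ x ∈ Θ, Tendsto (fun i => F i x) l (𝓝 (a x))) (ha : ContinuousOn a Θ) :
    TendstoLocallyUniformlyOn F a l Θ := by
  rw [Metric.tendstoLocallyUniformlyOn_iff]
  intro ε hε y hy
  obtain ⟨ρ, hρ, M, hball, hM⟩ := exists_ball_eventually_le (hΘ.mem_nhds hy) hF fun p hp =>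
    ⟨a p + 1, ((hlim p hp).eventually_lt_const (lt_add_one _)).mono fun _ h => h.le⟩
  have hlow : ∀ᶠ i in l, a y - 1 ≤ F i y :=
    ((hlim y hy).eventually_const_lt (sub_one_lt _)).mono fun _ h => h.le
  set K := (2 * (|M| + 2 * |a y - 1|) / (ρ / 2)).toNNReal
  have hnhds : {x | dist (a x) (a y) < ε / 3} ∩ Metric.ball y (min (ρ / 2) (ε / (3 * (K + 1))))
      ∈ 𝓝 y := by
    refine inter_mem ?_ (Metric.ball_mem_nhds _ (by positivity))
    exact (ha.continuousAt (hΘ.mem_nhds hy)) (Metric.ball_mem_nhds _ (by positivity))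
  refine ⟨_, mem_nhdsWithin_of_mem_nhds hnhds, ?_⟩
  filter_upwards [hF, hM, hlow, Metric.tendsto_nhds.1 (hlim y hy) (ε / 3) (by positivity)]
    with i hi hiM hil hiy x hx
  have hL := lipschitzOnWith_of_le_of_le hρ (hi.subset hball (convex_ball _ _)) hiM hil
  have hx2 : dist x y < min (ρ / 2) (ε / (3 * (K + 1))) := hx.2
  have h1 : dist (F i y) (F i x) ≤ K * dist y x :=
    hL.dist_le_mul y (Metric.mem_ball_self (by positivity)) x
      (Metric.mem_ball.2 (hx2.trans_le (min_le_left _ _)))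
  have h2 : K * dist y x ≤ ε / 3 := by
    rw [dist_comm]
    have h3 := hx2.le.trans (min_le_right _ _)
    rw [le_div_iff₀ (by positivity)] at h3
    nlinarith [dist_nonneg (x := x) (y := y), K.coe_nonneg]
  have h4 : dist (a x) (a y) < ε / 3 := hx.1
  have h5 := dist_triangle4 (a x) (a y) (F i y) (F i x)
  rw [dist_comm (F i y) (a y)] at hiy
  linarith

/-- If convex functions on the convex hull of an open set `Θ` converge on `Θ` to a steep
function, then `Θ` is itself convex: near a boundary point of `Θ` inside the convex
hull the functions would be uniformly Lipschitz, and the gradient of their limit bounded. -/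
theorem convex_of_steep [FiniteDimensional ℝ E] {ι : Type*} {l : Filter ι} [NeBot l]
    {Θ : Set E} (hΘ : IsOpen Θ) {F : ι → E → ℝ} {a : E → ℝ}
    (hF : ∀ᶠ i in l, ConvexOn ℝ (convexHull ℝ Θ) (F i))
    (hlim : ∀ x ∈ Θ, Tendsto (fun i => F i x) l (𝓝 (a x)))
    (hsteep : ∀ b ∈ frontier Θ, Tendsto (fun x => ‖gradient a x‖) (𝓝[Θ] b) atTop) :
    Convex ℝ Θ := by
  have : CompleteSpace E := FiniteDimensional.complete ℝ E
  have hCo : IsOpen (convexHull ℝ Θ) := hΘ.convexHull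
  have hbd : ∀ p ∈ convexHull ℝ Θ, ∃ M, ∀ᶠ i in l, F i p ≤ M := by
    intro p hp
    rw [convexHull_eq_union_convexHull_finite_subsets] at hp
    simp only [Set.mem_iUnion] at hp
    obtain ⟨t, htΘ, hp⟩ := hp
    have ht : t.Nonempty := Finset.coe_nonempty.1 (convexHull_nonempty_iff.1 ⟨p, hp⟩)
    refine ⟨t.sup' ht fun x => a x + 1, ?_⟩
    have hev : ∀ᶠ i in l, ∀ x ∈ t, F i x < a x + 1 :=
      (Finset.eventually_all t).2 fun x hx =>
        (hlim x (htΘ hx)).eventually_lt_const (lt_add_one _)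
    filter_upwards [hF, hev] with i hi hi'
    obtain ⟨x, hx, hle⟩ :=
      hi.exists_ge_of_mem_convexHull (htΘ.trans (subset_convexHull ℝ Θ)) hp
    exact hle.trans ((hi' x hx).le.trans (Finset.le_sup' (fun x => a x + 1) hx))
  have hdisj : ∀ b ∈ convexHull ℝ Θ, b ∉ frontier Θ := by
    intro b hb hfr
    obtain ⟨ρ, hρ, M, hball, hM⟩ := exists_ball_eventually_le (hCo.mem_nhds hb) hF hbd
    obtain ⟨y, hyΘ, hy⟩ := Metric.mem_closure_iff.1 (frontier_subset_closure hfr) (ρ / 4)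
      (by positivity)
    have hsub : Metric.ball y (ρ / 2) ⊆ Metric.ball b ρ :=
      Metric.ball_subset_ball' (by rw [dist_comm]; linarith)
    have hlow : ∀ᶠ i in l, a y - 1 ≤ F i y :=
      ((hlim y hyΘ).eventually_const_lt (sub_one_lt _)).mono fun _ h => h.le
    set K := (2 * (|M| + 2 * |a y - 1|) / (ρ / 2 / 2)).toNNReal
    have hL : LipschitzOnWith K a (Θ ∩ Metric.ball y (ρ / 2 / 2)) := by
      refine LipschitzOnWith.of_dist_le_mul fun u hu v hv => ?_
      refine le_of_tendsto ((hlim u hu.1).dist (hlim v hv.1)) ?_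
      filter_upwards [hF, hM, hlow] with i hi hiM hil
      exact (lipschitzOnWith_of_le_of_le (by positivity)
        (hi.subset (hsub.trans hball) (convex_ball _ _)) (fun x hx => hiM x (hsub hx))
        hil).dist_le_mul u hu.2 v hv.2
    have hopen : IsOpen (Θ ∩ Metric.ball y (ρ / 2 / 2)) := hΘ.inter Metric.isOpen_ball
    have : NeBot (𝓝[Θ] b) := mem_closure_iff_nhdsWithin_neBot.1 (frontier_subset_closure hfr)
    have hnear : ∀ᶠ x in 𝓝[Θ] b, x ∈ Θ ∩ Metric.ball y (ρ / 2 / 2) :=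
      inter_mem self_mem_nhdsWithin (mem_nhdsWithin_of_mem_nhds
        (Metric.isOpen_ball.mem_nhds (by rw [Metric.mem_ball]; linarith)))
    obtain ⟨x, hx, hgt⟩ := (hnear.and ((hsteep b hfr).eventually_gt_atTop (K : ℝ))).exists
    have hle := norm_fderiv_le_of_lipschitzOn ℝ (hopen.mem_nhds hx) hL
    rw [← toDual_gradient, LinearIsometryEquiv.norm_map] at hle
    linarith
  rcases Θ.eq_empty_or_nonempty with rfl | ⟨x, hx⟩
  · exact convex_empty
  have heq : convexHull ℝ Θ ⊆ Θ := by
    refine (convex_convexHull ℝ Θ).isPreconnected.subset_of_closure_inter_subset hΘ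
      ⟨x, subset_convexHull ℝ Θ hx, hx⟩ ?_
    rintro b ⟨hb, hbC⟩
    by_contra hbΘ
    exact hdisj b hbC ⟨hb, fun h => hbΘ (interior_subset h)⟩
  rw [← heq.antisymm (subset_convexHull ℝ Θ)]
  exact convex_convexHull ℝ Θ

/-- For a steep convex function, the derivative in the direction of an interior point `θ` tends to
`-∞` at the boundary. -/
theorem tendsto_inner_gradient_atBot [CompleteSpace E] {Θ : Set E} (hΘ : IsOpen Θ) {a : E → ℝ}
    (hconv : ConvexOn ℝ Θ a) (hdiff : DifferentiableOn ℝ a Θ) {θ b : E} (hθ : θ ∈ Θ)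
    (hb : Tendsto (fun x => ‖gradient a x‖) (𝓝[Θ] b) atTop) :
    Tendsto (fun x => ⟪gradient a x, θ - x⟫) (𝓝[Θ] b) atBot := by
  have hcont : ContinuousAt a θ := (hdiff.differentiableAt (hΘ.mem_nhds hθ)).continuousAt
  obtain ⟨ρ, hρ, hball⟩ := Metric.mem_nhds_iff.1 (inter_mem (hΘ.mem_nhds hθ)
    (hcont.eventually_lt_const (lt_add_one (a θ))))
  set C : ℝ := 1 + ‖gradient a θ‖ * (‖b - θ‖ + 1)
  have hlim : Tendsto (fun x => C - ρ / 2 * ‖gradient a x‖) (𝓝[Θ] b) atBot := by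
    simpa only [sub_eq_add_neg, Function.comp_def] using tendsto_atBot_add_const_left _ C
      (tendsto_neg_atTop_atBot.comp (hb.const_mul_atTop (half_pos hρ)))
  refine tendsto_atBot_mono' _ ?_ hlim
  have hnear : ∀ᶠ x in 𝓝[Θ] b, x ∈ Metric.ball b 1 :=
    mem_nhdsWithin_of_mem_nhds (Metric.ball_mem_nhds _ one_pos)
  filter_upwards [hnear, self_mem_nhdsWithin, hb.eventually_gt_atTop 0] with x hxb hx hpos
  -- test the tangent plane at `x` against the point of the ball around `θ` in direction `∇a(x)`
  set w := θ + (ρ / 2 / ‖gradient a x‖) • gradient a x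
  have hw : w ∈ Metric.ball θ ρ := by
    rw [Metric.mem_ball, dist_eq_norm, show w - θ = (ρ / 2 / ‖gradient a x‖) • gradient a x from
      add_sub_cancel_left _ _, norm_smul, Real.norm_of_nonneg (by positivity),
      div_mul_cancel₀ _ hpos.ne']
    linarith
  have h1 := add_inner_gradient_le hconv hx (hball hw).1
    (hdiff.differentiableAt (hΘ.mem_nhds hx))
  have h2 : a w < a θ + 1 := (hball hw).2
  have h3 := add_inner_gradient_le hconv hθ hx (hdiff.differentiableAt (hΘ.mem_nhds hθ))
  have h4 : ‖x - θ‖ ≤ ‖b - θ‖ + 1 := by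
    have := norm_add_le (x - b) (b - θ)
    rw [sub_add_sub_cancel] at this
    rw [Metric.mem_ball, dist_eq_norm] at hxb
    linarith
  have h5 : -(‖gradient a θ‖ * (‖b - θ‖ + 1)) ≤ ⟪gradient a θ, x - θ⟫ := by
    have h6 := neg_le_of_abs_le (abs_real_inner_le_norm (gradient a θ) (x - θ))
    have h7 := mul_le_mul_of_nonneg_left h4 (norm_nonneg (gradient a θ))
    linarith
  have h8 : ⟪gradient a x, w - x⟫ = ⟪gradient a x, θ - x⟫ + ρ / 2 * ‖gradient a x‖ := by
    rw [show w - x = (θ - x) + (ρ / 2 / ‖gradient a x‖) • gradient a x by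
      simp only [w]; abel, inner_add_right, inner_smul_right, real_inner_self_eq_norm_sq]
    field_simp
  simp only [C]
  linarith

/-- A steep convex function with a quadratic penalty attains its minimum. If `a` lies above an
affine function of slope `s` up to the constant `j` below its value at `θ`, the minimizer `φ` of
`a - ⟪·, s⟫ + (δ / 2) ‖· - θ‖²` shows that `s` is nearly a gradient of `a`. -/
theorem exists_gradient_eq [FiniteDimensional ℝ E] [CompleteSpace E] {Θ : Set E} (hΘ : IsOpen Θ)
    {a : E → ℝ} (hconv : ConvexOn ℝ Θ a) (hdiff : DifferentiableOn ℝ a Θ)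
    (hsteep : ∀ b ∈ frontier Θ, Tendsto (fun x => ‖gradient a x‖) (𝓝[Θ] b) atTop)
    {θ s : E} (hθ : θ ∈ Θ) {j δ : ℝ} (hδ : 0 < δ)
    (hj : ∀ φ ∈ Θ, ⟪φ - θ, s⟫ - (a φ - a θ) ≤ j) :
    ∃ φ ∈ Θ, gradient a φ = s - δ • (φ - θ) ∧ δ / 2 * ‖φ - θ‖ ^ 2 ≤ j := by
  have : ProperSpace E := FiniteDimensional.proper ℝ E
  set g : E → ℝ := fun x => a x - ⟪x - θ, s⟫ + δ / 2 * ‖x - θ‖ ^ 2 with hg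
  have hgcont : ContinuousOn g Θ := by
    have := hdiff.continuousOn
    simp only [hg]
    fun_prop
  have hlow : ∀ x ∈ Θ, a θ - j + δ / 2 * ‖x - θ‖ ^ 2 ≤ g x := by
    intro x hx
    have := hj x hx
    simp only [hg]
    linarith
  have hgθ : g θ = a θ := by simp [hg]
  have hbdd : BddBelow (g '' Θ) := by
    refine ⟨a θ - j, ?_⟩
    rintro _ ⟨x, hx, rfl⟩
    have := hlow x hx
    have : 0 ≤ δ / 2 * ‖x - θ‖ ^ 2 := by positivity
    linarith
  obtain ⟨u, -, hu, huΘ⟩ := exists_seq_tendsto_sInf (Set.Nonempty.image g ⟨θ, hθ⟩) hbdd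
  choose x hxΘ hxu using huΘ
  set m := sInf (g '' Θ)
  have hmle : ∀ y ∈ Θ, m ≤ g y := fun y hy => csInf_le hbdd ⟨y, hy, rfl⟩
  have hgx : Tendsto (fun n => g (x n)) atTop (𝓝 m) := by simpa only [hxu] using hu
  obtain ⟨R, hR0, hR⟩ : ∃ R : ℝ, 0 ≤ R ∧ ∀ᶠ n in atTop, ‖x n - θ‖ ≤ R := by
    refine ⟨Real.sqrt (2 / δ * |m + 1 - a θ + j|), Real.sqrt_nonneg _, ?_⟩
    filter_upwards [hgx.eventually_lt_const (lt_add_one m)] with n hn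
    apply Real.le_sqrt_of_sq_le
    have h1 := hlow (x n) (hxΘ n)
    have h2 := le_abs_self (m + 1 - a θ + j)
    have h3 : δ / 2 * ‖x n - θ‖ ^ 2 ≤ |m + 1 - a θ + j| := by linarith
    calc ‖x n - θ‖ ^ 2 = 2 / δ * (δ / 2 * ‖x n - θ‖ ^ 2) := by field_simp
      _ ≤ _ := by gcongr
  obtain ⟨b, -, k, hk, hxb⟩ := (isCompact_closedBall θ R).tendsto_subseq'
    (x := x) (hR.mono fun n hn => by simpa [dist_eq_norm] using hn).frequently
  have hbcl : b ∈ closure Θ := mem_closure_of_tendsto hxb (Eventually.of_forall fun n => hxΘ _)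
  have hgk : Tendsto (fun n => g (x (k n))) atTop (𝓝 m) := hgx.comp hk.tendsto_atTop
  have hbΘ : b ∈ Θ := by
    by_contra hbΘ
    have hfr : b ∈ frontier Θ := ⟨hbcl, fun h => hbΘ (interior_subset h)⟩
    have hin := tendsto_inner_gradient_atBot hΘ hconv hdiff hθ (hsteep b hfr)
    have hN := hin.eventually_le_atBot (-(‖s‖ * R + 1))
    obtain ⟨ρ, hρ, hball⟩ := Metric.mem_nhdsWithin_iff.1 hN
    -- moving from `x n` towards `θ` by a fixed small proportion `τ` lowers `g` by at least `τ`
    set τ : ℝ := min (1 / 2) (ρ / (2 * (R + 1)))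
    have hτ0 : 0 < τ := by positivity
    have hτ1 : τ ≤ 1 / 2 := min_le_left _ _
    have hτρ : τ * R < ρ / 2 := by
      have h1 : τ * (2 * (R + 1)) ≤ ρ := by
        rw [← le_div_iff₀ (by positivity)]; exact min_le_right _ _
      nlinarith
    have hdec : ∀ᶠ n in atTop, m + τ ≤ g (x (k n)) := by
      have hnear : ∀ᶠ n in atTop, dist (x (k n)) b < ρ / 2 :=
        Metric.tendsto_nhds.1 hxb _ (by positivity)
      filter_upwards [hnear, hk.tendsto_atTop.eventually hR] with n hn hnR
      set z := x (k n)
      have hz : z ∈ Θ := hxΘ _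
      set y := z + τ • (θ - z)
      have hy : y ∈ Θ := by
        have := hconv.1 hz hθ (show 0 ≤ 1 - τ by linarith) hτ0.le (by ring)
        rwa [show (1 - τ) • z + τ • θ = y by simp only [y]; module] at this
      have hyb : y ∈ Metric.ball b ρ := by
        rw [Metric.mem_ball]
        have h1 : dist y z = τ * ‖z - θ‖ := by
          rw [dist_eq_norm, show y - z = τ • (θ - z) from add_sub_cancel_left _ _, norm_smul,
            Real.norm_of_nonneg hτ0.le, norm_sub_rev]
        have h2 := dist_triangle y z b
        have h3 : τ * ‖z - θ‖ ≤ τ * R := by gcongr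
        linarith
      have h1 : ⟪gradient a y, θ - y⟫ ≤ -(‖s‖ * R + 1) := hball ⟨hyb, hy⟩
      have h2 := add_inner_gradient_le hconv hy hz (hdiff.differentiableAt (hΘ.mem_nhds hy))
      rw [show z - y = -τ • (θ - z) by simp only [y]; module, inner_smul_right] at h2
      rw [show θ - y = (1 - τ) • (θ - z) by simp only [y]; module, inner_smul_right] at h1
      have h3 : ⟪gradient a y, θ - z⟫ ≤ -(‖s‖ * R + 1) := by
        have : 0 ≤ ‖s‖ * R := by positivity
        nlinarith
      have h4 : ‖y - θ‖ ^ 2 ≤ ‖z - θ‖ ^ 2 := by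
        rw [show y - θ = (1 - τ) • (z - θ) by simp only [y]; module, norm_smul,
          Real.norm_of_nonneg (by linarith)]
        have : (1 - τ) * ‖z - θ‖ ≤ ‖z - θ‖ := by nlinarith [norm_nonneg (z - θ)]
        exact pow_le_pow_left₀ (mul_nonneg (by linarith) (norm_nonneg _)) this 2
      have h5 : ⟪y - θ, s⟫ - ⟪z - θ, s⟫ = -τ * ⟪z - θ, s⟫ := by
        rw [← inner_sub_left, show y - θ - (z - θ) = -τ • (z - θ) by simp only [y]; module,
          real_inner_smul_left]
      have h6 : ⟪z - θ, s⟫ ≤ ‖s‖ * R := by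
        have h7 := real_inner_le_norm (z - θ) s
        have h8 : ‖z - θ‖ * ‖s‖ ≤ R * ‖s‖ := by gcongr
        linarith
      have h9 := hmle y hy
      have h10 : τ * ⟪gradient a y, θ - z⟫ ≤ τ * -(‖s‖ * R + 1) := by gcongr
      have h11 : τ * ⟪z - θ, s⟫ ≤ τ * (‖s‖ * R) := by gcongr
      have h12 : δ / 2 * ‖y - θ‖ ^ 2 ≤ δ / 2 * ‖z - θ‖ ^ 2 := by gcongr
      simp only [hg] at h9 ⊢
      linarith
    have := ge_of_tendsto hgk hdec
    linarith
  have hgb : g b = m :=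
    tendsto_nhds_unique ((hgcont.continuousAt (hΘ.mem_nhds hbΘ)).tendsto.comp hxb) hgk
  refine ⟨b, hbΘ, ?_, ?_⟩
  · have hmin : IsLocalMin g b := by
      filter_upwards [hΘ.mem_nhds hbΘ] with y hy
      exact hgb.trans_le (hmle y hy)
    have hgrad : HasGradientAt g (gradient a b - s + δ • (b - θ)) b := by
      have h1 := (hdiff.differentiableAt (hΘ.mem_nhds hbΘ)).hasFDerivAt
      have h2 : HasFDerivAt (fun x : E => x - θ) (ContinuousLinearMap.id ℝ E) b :=
        (hasFDerivAt_id b).sub_const θ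
      have h3 := (h1.sub (h2.inner ℝ (hasFDerivAt_const s b))).add (h2.norm_sq.const_mul (δ / 2))
      rw [hasGradientAt_iff_hasFDerivAt]
      refine h3.congr_fderiv ?_
      ext v
      simp [real_inner_comm s v, fderivInnerCLM_apply]
      ring
    have h0 := gradient_eq_zero_of_isLocalMin hmin hgrad
    rw [← sub_eq_zero, ← h0]
    abel
  · have h1 := hlow b hbΘ
    have h2 := hmle θ hθ
    linarith

end Convex

/-! ### A single exponential family -/

section Family

variable {d : ℕ} {X : Type*} {t : X → EuclideanSpace ℝ (Fin d)} {θ φ : EuclideanSpace ℝ (Fin d)}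

theorem partitionFn_pos [Nonempty X] (h : Summable fun x => Real.exp ⟪θ, t x⟫) :
    0 < partitionFn t θ :=
  h.tsum_pos (fun _ => (Real.exp_pos _).le) (Classical.arbitrary X) (Real.exp_pos _)

theorem density_eq_exp [Nonempty X] (h : Summable fun x => Real.exp ⟪θ, t x⟫) (x : X) :
    density t θ x = Real.exp (⟪θ, t x⟫ - logPartition t θ) := by
  rw [density, logPartition, Real.exp_sub, Real.exp_log (partitionFn_pos h)]

/-- The set of parameters with finite partition function is convex, and the log-partition function
is convex on it, by Hölder's inequality. -/
theorem convexOn_logPartition [Nonempty X] :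
    ConvexOn ℝ {θ | Summable fun x => Real.exp ⟪θ, t x⟫} (logPartition t) := by
  have hconv : Convex ℝ {θ | Summable fun x => Real.exp ⟪θ, t x⟫} := by
    intro θ hθ φ hφ α β hα hβ hαβ
    refine Summable.of_nonneg_of_le (fun _ => (Real.exp_pos _).le) (fun x => ?_)
      ((hθ.mul_left α).add (hφ.mul_left β))
    have h := convexOn_exp.2 (Set.mem_univ ⟪θ, t x⟫) (Set.mem_univ ⟪φ, t x⟫) hα hβ hαβ
    simpa [inner_add_left, real_inner_smul_left] using h
  refine convexOn_iff_forall_pos.2 ⟨hconv, ?_⟩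
  intro θ hθ φ hφ α β hα hβ hαβ
  have hzθ := partitionFn_pos hθ
  have hzφ := partitionFn_pos hφ
  have hrpow : ∀ (γ : ℝ) (u : ℝ), 0 < γ → (Real.exp (γ * u)) ^ (1 / γ) = Real.exp u := by
    intro γ u hγ
    rw [← Real.exp_mul]
    congr 1
    field_simp
  have hHolder : (1 / α).HolderConjugate (1 / β) := by
    refine Real.holderConjugate_iff.2 ⟨?_, by simpa using hαβ⟩
    rw [lt_div_iff₀ hα]
    linarith
  have h := Real.inner_le_Lp_mul_Lq_tsum_of_nonneg hHolder
    (f := fun x => Real.exp (α * ⟪θ, t x⟫)) (g := fun x => Real.exp (β * ⟪φ, t x⟫))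
    (fun _ => (Real.exp_pos _).le) (fun _ => (Real.exp_pos _).le)
    (by simp only [hrpow α _ hα]; exact hθ) (by simp only [hrpow β _ hβ]; exact hφ)
  simp only [hrpow α _ hα, hrpow β _ hβ, one_div_one_div, ← Real.exp_add] at h
  have hz : partitionFn t (α • θ + β • φ) ≤ partitionFn t θ ^ α * partitionFn t φ ^ β := by
    simpa only [partitionFn, inner_add_left, real_inner_smul_left] using h
  have hpos : 0 < partitionFn t (α • θ + β • φ) :=
    partitionFn_pos (hconv hθ hφ hα.le hβ.le hαβ)
  have hlog := Real.log_le_log hpos hz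
  rwa [Real.log_mul (by positivity) (by positivity), Real.log_rpow hzθ, Real.log_rpow hzφ] at hlog

variable [MeasurableSpace X] [MeasurableSingletonClass X] [Nonempty X]

theorem isProbabilityMeasure_law (h : Summable fun x => Real.exp ⟪θ, t x⟫) :
    IsProbabilityMeasure (law t θ) := by
  constructor
  have hz := partitionFn_pos h
  rw [law, withDensity_apply _ MeasurableSet.univ, Measure.restrict_univ, lintegral_count]
  simp only [density]
  rw [← ENNReal.ofReal_tsum_of_nonneg (fun x => div_nonneg (Real.exp_pos _).le hz.le)
      (h.div_const _), tsum_div_const]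
  change ENNReal.ofReal (partitionFn t θ / partitionFn t θ) = 1
  rw [div_self hz.ne', ENNReal.ofReal_one]

variable [Countable X]

/-- Change of parameter: a bound for the log-likelihood ratio on an event bounds the probability
of that event. -/
theorem law_le_ofReal_exp_mul_law (hθ : Summable fun x => Real.exp ⟪θ, t x⟫)
    (hφ : Summable fun x => Real.exp ⟪φ, t x⟫) {S : Set X} {c : ℝ}
    (h : ∀ x ∈ S, ⟪θ - φ, t x⟫ - (logPartition t θ - logPartition t φ) ≤ c) :
    law t θ S ≤ ENNReal.ofReal (Real.exp c) * law t φ S := by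
  have hS : MeasurableSet S := S.to_countable.measurableSet
  rw [law, law, withDensity_apply _ hS, withDensity_apply _ hS,
    ← lintegral_const_mul' _ _ ENNReal.ofReal_ne_top]
  refine setLIntegral_mono' hS fun x hx => ?_
  rw [← ENNReal.ofReal_mul (Real.exp_pos _).le, density_eq_exp hθ, density_eq_exp hφ,
    ← Real.exp_add]
  have := h x hx
  rw [inner_sub_left] at this
  exact ENNReal.ofReal_le_ofReal (Real.exp_le_exp.2 (by linarith))

/-- The Chernoff bound for a half-space. -/
theorem law_halfSpace_le (hθ : Summable fun x => Real.exp ⟪θ, t x⟫)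
    (hφ : Summable fun x => Real.exp ⟪φ, t x⟫) (c : ℝ) :
    law t θ {x | c ≤ ⟪φ - θ, t x⟫} ≤
      ENNReal.ofReal (Real.exp (logPartition t φ - logPartition t θ - c)) := by
  have := isProbabilityMeasure_law hφ
  refine (law_le_ofReal_exp_mul_law hθ hφ
    (c := logPartition t φ - logPartition t θ - c) fun x hx => ?_).trans
    (mul_le_of_le_one_right' prob_le_one)
  have hx' : c ≤ ⟪φ - θ, t x⟫ := hx
  rw [← neg_sub φ θ, inner_neg_left]
  linarith

end Family

/-! ### Exponential bounds along the scale limit -/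

section ScaledLog

variable {r c : ℝ} {p : ℝ≥0∞}

theorem scaledLog_mono (hr : 0 < r) : Monotone (scaledLog r) := fun _ _ h =>
  mul_le_mul_of_nonneg_left (ENNReal.log_monotone h) (EReal.coe_nonneg.2 (inv_pos.2 hr).le)

theorem scaledLog_ofReal_exp (hr : 0 < r) :
    scaledLog r (ENNReal.ofReal (Real.exp (r * c))) = c := by
  rw [scaledLog, ENNReal.log_ofReal_of_pos (Real.exp_pos _), Real.log_exp, ← EReal.coe_mul,
    inv_mul_cancel_left₀ hr.ne']

end ScaledLog

section Limit

variable {d : ℕ} {ι : Type*} {X : ι → Type*} [∀ i, Countable (X i)] [∀ i, Nonempty (X i)]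
  [∀ i, MeasurableSpace (X i)] [∀ i, MeasurableSingletonClass (X i)]
  {t : ∀ i, X i → EuclideanSpace ℝ (Fin d)} {Θ : Set (EuclideanSpace ℝ (Fin d))} {r : ι → ℝ}
  {a : EuclideanSpace ℝ (Fin d) → ℝ} {θ : EuclideanSpace ℝ (Fin d)}

theorem tendsto_scaleLimit : Tendsto r (scaleLimit r) atTop := tendsto_comap

/-- A closed set on which the rate function exceeds `c` is covered by finitely many half-spaces,
each given by a parameter `φ ∈ Θ` that witnesses the bound `c`. Outside a large ball, increments
`φ - θ` of a fixed small length in finitely many directions suffice. -/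
theorem exists_finset_halfSpaces (hΘ : IsOpen Θ) (hθ : θ ∈ Θ)
    {F : Set (EuclideanSpace ℝ (Fin d))} (hF : IsClosed F) {c : ℝ}
    (hc : ∀ s ∈ F, (c : EReal) < rate Θ a θ s) :
    ∃ T : Finset (EuclideanSpace ℝ (Fin d)), ↑T ⊆ Θ ∧
      ∀ s ∈ F, ∃ φ ∈ T, c + (a φ - a θ) ≤ ⟪φ - θ, s⟫ := by
  classical
  obtain ⟨h, hh, hball⟩ := Metric.nhds_basis_closedBall.mem_iff.1 (hΘ.mem_nhds hθ)
  obtain ⟨T₀, hT₀, hcov₀⟩ := (isCompact_sphere (0 : EuclideanSpace ℝ (Fin d)) 1).elim_nhds_subcover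
    (fun u => {v | 1 / 2 < ⟪u, v⟫}) fun u hu => by
      refine (isOpen_lt (by fun_prop) (by fun_prop)).mem_nhds ?_
      rw [mem_sphere_zero_iff_norm] at hu
      simp only [Set.mem_ofPred_eq, real_inner_self_eq_norm_sq, hu]
      norm_num
  set M : ℝ := ∑ u ∈ T₀, |c + (a (θ + h • u) - a θ)| with hM
  have hM0 : 0 ≤ M := Finset.sum_nonneg fun _ _ => abs_nonneg _
  have hfar : ∀ s : EuclideanSpace ℝ (Fin d), 2 * M / h < ‖s‖ →
      ∃ u ∈ T₀, c + (a (θ + h • u) - a θ) ≤ ⟪h • u, s⟫ := by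
    intro s hs
    have hs0 : 0 < ‖s‖ := lt_of_le_of_lt (by positivity) hs
    have hmem : ‖s‖⁻¹ • s ∈ Metric.sphere (0 : EuclideanSpace ℝ (Fin d)) 1 := by
      rw [mem_sphere_zero_iff_norm, norm_smul, norm_inv, norm_norm, inv_mul_cancel₀ hs0.ne']
    obtain ⟨u, hu, hus⟩ := Set.mem_iUnion₂.1 (hcov₀ hmem)
    refine ⟨u, hu, ?_⟩
    have h1 : 1 / 2 < ‖s‖⁻¹ * ⟪u, s⟫ := by simpa [real_inner_smul_right] using hus
    have h2 : ‖s‖ / 2 < ⟪u, s⟫ := by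
      rw [inv_mul_eq_div, lt_div_iff₀ hs0] at h1
      linarith
    have h3 : |c + (a (θ + h • u) - a θ)| ≤ M :=
      Finset.single_le_sum (f := fun u => |c + (a (θ + h • u) - a θ)|)
        (fun _ _ => abs_nonneg _) hu
    rw [div_lt_iff₀ hh] at hs
    rw [real_inner_smul_left]
    nlinarith [le_abs_self (c + (a (θ + h • u) - a θ))]
  have hK : IsCompact (F ∩ Metric.closedBall 0 (2 * M / h)) :=
    (isCompact_closedBall _ _).inter_left hF
  obtain ⟨T₁, hT₁⟩ := hK.elim_finite_subcover
    (fun φ : Θ => {s | c + (a φ - a θ) < ⟪(φ : EuclideanSpace ℝ (Fin d)) - θ, s⟫})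
    (fun φ => isOpen_lt (by fun_prop) (by fun_prop)) (by
      rintro s ⟨hs, -⟩
      obtain ⟨φ, hφ⟩ := lt_iSup_iff.1 (hc s hs)
      obtain ⟨hφΘ, hφ⟩ := lt_iSup_iff.1 hφ
      refine Set.mem_iUnion.2 ⟨⟨θ + φ, hφΘ⟩, ?_⟩
      have := EReal.coe_lt_coe_iff.1 hφ
      simp only [Set.mem_ofPred_eq, add_sub_cancel_left]
      linarith)
  refine ⟨T₀.image (fun u => θ + h • u) ∪ T₁.image Subtype.val, ?_, ?_⟩
  · intro φ hφ
    rcases Finset.mem_union.1 (Finset.mem_coe.1 hφ) with hφ | hφ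
    · obtain ⟨u, hu, rfl⟩ := Finset.mem_image.1 hφ
      have hu1 := mem_sphere_zero_iff_norm.1 (hT₀ u hu)
      apply hball
      rw [mem_closedBall_iff_norm, add_sub_cancel_left, norm_smul, hu1,
        Real.norm_of_nonneg hh.le, mul_one]
    · obtain ⟨φ, -, rfl⟩ := Finset.mem_image.1 hφ
      exact φ.2
  · intro s hs
    by_cases hsR : ‖s‖ ≤ 2 * M / h
    · obtain ⟨φ, hφ, hlt⟩ := Set.mem_iUnion₂.1 (hT₁ ⟨hs, by simpa using hsR⟩)
      exact ⟨φ, Finset.mem_union_right _ (Finset.mem_image_of_mem _ hφ), le_of_lt hlt⟩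
    · obtain ⟨u, hu, hle⟩ := hfar s (not_le.1 hsR)
      exact ⟨θ + h • u, Finset.mem_union_left _ (Finset.mem_image_of_mem _ hu), by
        rwa [add_sub_cancel_left]⟩

/-- The large deviation upper bound in exponential form. -/
theorem eventually_law_le (hΘ : IsOpen Θ)
    (hsum : ∀ i, ∀ φ ∈ Θ, Summable fun x => Real.exp ⟪φ, t i x⟫)
    (hscale : ∀ φ ∈ Θ,
      Tendsto (fun i => logPartition (t i) φ / r i) (scaleLimit r) (𝓝 (a φ)))
    (hθ : θ ∈ Θ) {F : Set (EuclideanSpace ℝ (Fin d))} (hF : IsClosed F) {c c' : ℝ}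
    (hc : ∀ s ∈ F, (c : EReal) < rate Θ a θ s) (hc' : c' < c) :
    ∀ᶠ i in scaleLimit r, law (t i) θ {x | (r i)⁻¹ • t i x ∈ F} ≤
      ENNReal.ofReal (Real.exp (r i * -c')) := by
  obtain ⟨T, hTΘ, hT⟩ := exists_finset_halfSpaces hΘ hθ hF hc
  set η := (c - c') / 2 with hη
  have hη0 : 0 < η := by linarith
  have hr := tendsto_scaleLimit (r := r)
  have hconv : ∀ᶠ i in scaleLimit r, ∀ φ ∈ T,
      logPartition (t i) φ / r i - logPartition (t i) θ / r i < a φ - a θ + η :=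
    (Finset.eventually_all T).2 fun φ hφ =>
      ((hscale φ (hTΘ hφ)).sub (hscale θ hθ)).eventually_lt_const (by linarith)
  have hcard : ∀ᶠ i in scaleLimit r, (T.card : ℝ) ≤ Real.exp (r i * η) :=
    (Real.tendsto_exp_atTop.comp (hr.atTop_mul_const hη0)).eventually_ge_atTop _
  filter_upwards [hconv, hcard, hr.eventually_gt_atTop 0] with i hi hci hri
  have hsub : {x | (r i)⁻¹ • t i x ∈ F} ⊆
      ⋃ φ ∈ T, {x | r i * (c + (a φ - a θ)) ≤ ⟪φ - θ, t i x⟫} := by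
    intro x hx
    obtain ⟨φ, hφ, hle⟩ := hT _ hx
    refine Set.mem_iUnion₂.2 ⟨φ, hφ, ?_⟩
    rw [real_inner_smul_right, inv_mul_eq_div, le_div_iff₀ hri] at hle
    rw [Set.mem_ofPred_eq]
    linarith
  calc law (t i) θ {x | (r i)⁻¹ • t i x ∈ F}
      ≤ ∑ φ ∈ T, law (t i) θ {x | r i * (c + (a φ - a θ)) ≤ ⟪φ - θ, t i x⟫} :=
        (measure_mono hsub).trans (measure_biUnion_finset_le _ _)
    _ ≤ ∑ φ ∈ T, ENNReal.ofReal (Real.exp (r i * -(c' + η))) := by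
        refine Finset.sum_le_sum fun φ hφ =>
          (law_halfSpace_le (hsum i θ hθ) (hsum i φ (hTΘ hφ)) _).trans
            (ENNReal.ofReal_le_ofReal (Real.exp_le_exp.2 ?_))
        have h1 := hi φ hφ
        rw [← sub_div, div_lt_iff₀ hri] at h1
        have h2 : c' + η = c - η := by linarith
        rw [h2]
        linarith
    _ = ENNReal.ofReal (T.card * Real.exp (r i * -(c' + η))) := by
        rw [Finset.sum_const, nsmul_eq_mul, ENNReal.ofReal_mul (Nat.cast_nonneg _),
          ENNReal.ofReal_natCast]
    _ ≤ ENNReal.ofReal (Real.exp (r i * -c')) := by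
        refine ENNReal.ofReal_le_ofReal ?_
        calc T.card * Real.exp (r i * -(c' + η))
            ≤ Real.exp (r i * η) * Real.exp (r i * -(c' + η)) := by gcongr
          _ = Real.exp (r i * -c') := by rw [← Real.exp_add]; ring_nf

/-- The weak law of large numbers. Differentiability of `a` at `θ` bounds the rate function below
by a positive constant away from the gradient. -/
theorem tendsto_law_norm_sub_gradient (hΘ : IsOpen Θ)
    (hsum : ∀ i, ∀ φ ∈ Θ, Summable fun x => Real.exp ⟪φ, t i x⟫)
    (hscale : ∀ φ ∈ Θ,
      Tendsto (fun i => logPartition (t i) φ / r i) (scaleLimit r) (𝓝 (a φ)))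
    (hθ : θ ∈ Θ) (hd : DifferentiableAt ℝ a θ) {ε : ℝ} (hε : 0 < ε) :
    Tendsto (fun i => law (t i) θ {x | ε ≤ ‖(r i)⁻¹ • t i x - gradient a θ‖})
      (scaleLimit r) (𝓝 0) := by
  have hlittle := (hasGradientAt_iff_isLittleO.1 hd.hasGradientAt).def (half_pos hε)
  obtain ⟨h, hh, hball⟩ := Metric.nhds_basis_closedBall.mem_iff.1
    (inter_mem (hΘ.mem_nhds hθ) hlittle)
  have hF : IsClosed {s : EuclideanSpace ℝ (Fin d) | ε ≤ ‖s - gradient a θ‖} :=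
    isClosed_le (by fun_prop) (by fun_prop)
  have hrate : ∀ s ∈ {s : EuclideanSpace ℝ (Fin d) | ε ≤ ‖s - gradient a θ‖},
      ((ε * h / 4 : ℝ) : EReal) < rate Θ a θ s := by
    intro s hs
    rw [Set.mem_ofPred_eq] at hs
    have hs0 : 0 < ‖s - gradient a θ‖ := hε.trans_le hs
    set v := (h / ‖s - gradient a θ‖) • (s - gradient a θ) with hv
    have hvn : ‖v‖ = h := by
      rw [hv, norm_smul, Real.norm_of_nonneg (by positivity), div_mul_cancel₀ _ hs0.ne']
    have hmem := hball (a := θ + v) (by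
      rw [mem_closedBall_iff_norm, add_sub_cancel_left, hvn])
    have h1 : ‖a (θ + v) - a θ - ⟪gradient a θ, θ + v - θ⟫‖ ≤ ε / 2 * ‖θ + v - θ‖ := hmem.2
    rw [add_sub_cancel_left, hvn, Real.norm_eq_abs] at h1
    have h2 : ⟪v, s - gradient a θ⟫ = h * ‖s - gradient a θ‖ := by
      rw [hv, real_inner_smul_left, real_inner_self_eq_norm_sq]
      field_simp
    rw [inner_sub_right, real_inner_comm] at h2
    have h3 : h * ε ≤ h * ‖s - gradient a θ‖ := by gcongr
    have h4 := (abs_le.1 h1).2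
    rw [real_inner_comm] at h2
    refine lt_of_lt_of_le (EReal.coe_lt_coe_iff.2 ?_)
      (le_iSup₂ (f := fun φ (_ : θ + φ ∈ Θ) => ((⟪φ, s⟫ - (a (θ + φ) - a θ) : ℝ) : EReal))
        v hmem.1)
    have : 0 < ε * h := by positivity
    have h5 : ⟪gradient a θ, v⟫ = ⟪v, gradient a θ⟫ := real_inner_comm _ _
    linarith
  have hup := eventually_law_le hΘ hsum hscale hθ hF hrate
    (show ε * h / 8 < ε * h / 4 by have : 0 < ε * h := by positivity
                                   linarith)
  have hlim : Tendsto (fun i => ENNReal.ofReal (Real.exp (r i * -(ε * h / 8))))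
      (scaleLimit r) (𝓝 0) := by
    rw [← ENNReal.ofReal_zero]
    refine (ENNReal.continuous_ofReal.tendsto 0).comp (Real.tendsto_exp_atBot.comp ?_)
    exact tendsto_scaleLimit.atTop_mul_const_of_neg (neg_neg_of_pos (by positivity))
  exact tendsto_of_tendsto_of_tendsto_of_le_of_le' tendsto_const_nhds hlim
    (Eventually.of_forall fun _ => zero_le) hup

/-- The large deviation lower bound at a gradient `∇a(φ)`, by tilting to the parameter `φ`, under
which `∇a(φ)` is the typical value. -/
theorem eventually_le_law (hΘ : IsOpen Θ)
    (hsum : ∀ i, ∀ φ ∈ Θ, Summable fun x => Real.exp ⟪φ, t i x⟫)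
    (hscale : ∀ φ ∈ Θ,
      Tendsto (fun i => logPartition (t i) φ / r i) (scaleLimit r) (𝓝 (a φ)))
    (hθ : θ ∈ Θ) {φ : EuclideanSpace ℝ (Fin d)} (hφ : φ ∈ Θ) (hd : DifferentiableAt ℝ a φ)
    {K : Set (EuclideanSpace ℝ (Fin d))} (hK : K ∈ 𝓝 (gradient a φ)) {c : ℝ}
    (hc : c < -(⟪φ - θ, gradient a φ⟫ - (a φ - a θ))) :
    ∀ᶠ i in scaleLimit r, ENNReal.ofReal (Real.exp (r i * c)) ≤
      law (t i) θ {x | (r i)⁻¹ • t i x ∈ K} := by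
  set v := gradient a φ with hv
  set γ := -(⟪φ - θ, v⟫ - (a φ - a θ)) - c with hγ
  have hγ0 : 0 < γ := by linarith
  obtain ⟨η₀, hη₀, hballK⟩ := Metric.mem_nhds_iff.1 hK
  set η := min η₀ (γ / (3 * (‖φ - θ‖ + 1))) with hη
  have hη0 : 0 < η := by positivity
  have hηγ : η * ‖φ - θ‖ ≤ γ / 3 := by
    have h1 : η * (3 * (‖φ - θ‖ + 1)) ≤ γ := by
      rw [← le_div_iff₀ (by positivity)]; exact min_le_right _ _
    nlinarith [norm_nonneg (φ - θ)]
  have hr := tendsto_scaleLimit (r := r)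
  have htyp : ∀ᶠ i in scaleLimit r, law (t i) φ {x | η ≤ ‖(r i)⁻¹ • t i x - v‖} ≤ 2⁻¹ :=
    (tendsto_law_norm_sub_gradient hΘ hsum hscale hφ hd hη0).eventually_le_const (by simp)
  have hlim : ∀ᶠ i in scaleLimit r,
      a φ - a θ - γ / 3 < logPartition (t i) φ / r i - logPartition (t i) θ / r i :=
    ((hscale φ hφ).sub (hscale θ hθ)).eventually_const_lt (by linarith)
  have hexp : ∀ᶠ i in scaleLimit r, Real.exp (r i * -(γ / 3)) < 2⁻¹ :=
    (Real.tendsto_exp_atBot.comp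
      (hr.atTop_mul_const_of_neg (neg_neg_of_pos (by positivity)))).eventually_lt_const
      (by norm_num)
  filter_upwards [htyp, hlim, hexp, hr.eventually_gt_atTop 0] with i h1 h2 h3 hri
  set S := {x | ‖(r i)⁻¹ • t i x - v‖ < η}
  have hP := isProbabilityMeasure_law (hsum i φ hφ)
  have hS : 2⁻¹ ≤ law (t i) φ S := by
    have hcompl : Sᶜ = {x | η ≤ ‖(r i)⁻¹ • t i x - v‖} := by ext x; simp [S]
    have h4 := prob_add_prob_compl (μ := law (t i) φ) S.to_countable.measurableSet
    rw [hcompl] at h4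
    by_contra! hlt
    have h5 := ENNReal.add_lt_add_of_lt_of_le (by simp) hlt h1
    rw [h4, ENNReal.inv_two_add_inv_two] at h5
    exact lt_irrefl _ h5
  have hchange := law_le_ofReal_exp_mul_law (hsum i φ hφ) (hsum i θ hθ) (S := S)
    (c := r i * (-c - γ / 3)) fun x hx => by
      have hx' : ‖(r i)⁻¹ • t i x - v‖ < η := hx
      have h4 : ⟪φ - θ, (r i)⁻¹ • t i x - v⟫ ≤ γ / 3 := by
        refine (real_inner_le_norm _ _).trans (le_trans ?_ hηγ)
        rw [mul_comm]
        gcongr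
      rw [inner_sub_right, real_inner_smul_right, sub_le_iff_le_add, inv_mul_eq_div,
        div_le_iff₀ hri] at h4
      rw [← sub_div, lt_div_iff₀ hri] at h2
      have h5 : -c - γ / 3 = (γ / 3 + ⟪φ - θ, v⟫) - (a φ - a θ - γ / 3) := by linarith
      rw [h5]
      linarith
  have hmono : law (t i) θ S ≤ law (t i) θ {x | (r i)⁻¹ • t i x ∈ K} :=
    measure_mono fun x hx => hballK (by
      rw [Metric.mem_ball, dist_eq_norm]
      exact lt_of_lt_of_le hx (min_le_left _ _))
  refine le_trans ?_ hmono
  have hcancel : ENNReal.ofReal (Real.exp (r i * (c + γ / 3))) *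
      ENNReal.ofReal (Real.exp (r i * (-c - γ / 3))) = 1 := by
    rw [← ENNReal.ofReal_mul (Real.exp_pos _).le, ← Real.exp_add]
    ring_nf
    simp
  calc ENNReal.ofReal (Real.exp (r i * c))
      = ENNReal.ofReal (Real.exp (r i * (c + γ / 3))) *
          ENNReal.ofReal (Real.exp (r i * -(γ / 3))) := by
        rw [← ENNReal.ofReal_mul (Real.exp_pos _).le, ← Real.exp_add]
        ring_nf
    _ ≤ ENNReal.ofReal (Real.exp (r i * (c + γ / 3))) * 2⁻¹ := by
        gcongr
        rw [← ENNReal.ofReal_ofNat 2, ← ENNReal.ofReal_inv_of_pos two_pos]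
        exact ENNReal.ofReal_le_ofReal h3.le
    _ ≤ ENNReal.ofReal (Real.exp (r i * (c + γ / 3))) *
          (ENNReal.ofReal (Real.exp (r i * (-c - γ / 3))) * law (t i) θ S) := by
        gcongr
        exact hS.trans hchange
    _ = law (t i) θ S := by rw [← mul_assoc, hcancel, one_mul]

end Limit

/-! ### Maximum likelihood -/

/-- A convex function that is larger on a sphere than at its centre attains its minimum, and does
so inside the sphere only. -/
theorem exists_isMinOn_and_norm_sub_lt {E : Type*} [NormedAddCommGroup E] [NormedSpace ℝ E]
    [ProperSpace E] {Θ : Set E} {f : E → ℝ} (hf : ConvexOn ℝ Θ f) (hcont : ContinuousOn f Θ)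
    {θ : E} {ε : ℝ} (hε : 0 < ε) (hball : Metric.closedBall θ ε ⊆ Θ)
    (hsphere : ∀ y ∈ Metric.sphere θ ε, f θ < f y) :
    (∃ z ∈ Θ, IsMinOn f Θ z) ∧ ∀ z ∈ Θ, IsMinOn f Θ z → ‖z - θ‖ < ε := by
  have hθball : θ ∈ Metric.closedBall θ ε := Metric.mem_closedBall_self hε.le
  have hout : ∀ y ∈ Θ, ε ≤ ‖y - θ‖ → f θ < f y := by
    intro y hy hle
    have hpos : 0 < ‖y - θ‖ := hε.trans_le hle
    set τ := ε / ‖y - θ‖ with hτ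
    have hτ0 : 0 < τ := by positivity
    have hτ1 : τ ≤ 1 := (div_le_one hpos).2 hle
    -- the point where the segment from `θ` to `y` crosses the sphere
    have hp : (1 - τ) • θ + τ • y ∈ Metric.sphere θ ε := by
      rw [mem_sphere_iff_norm, show (1 - τ) • θ + τ • y - θ = τ • (y - θ) by module, norm_smul,
        Real.norm_of_nonneg hτ0.le, hτ, div_mul_cancel₀ _ hpos.ne']
    have h1 := hsphere _ hp
    have h2 := hf.2 (hball hθball) hy (sub_nonneg.2 hτ1) hτ0.le (sub_add_cancel 1 τ)
    simp only [smul_eq_mul] at h2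
    nlinarith
  constructor
  · obtain ⟨z, hz, hmin⟩ := (isCompact_closedBall θ ε).exists_isMinOn ⟨θ, hθball⟩
      (hcont.mono hball)
    refine ⟨z, hball hz, fun y hy => ?_⟩
    by_cases hle : ε ≤ ‖y - θ‖
    · exact (hmin hθball).trans (hout y hy hle).le
    · exact hmin (mem_closedBall_iff_norm.2 (not_le.1 hle).le)
  · intro z hz hmin
    by_contra! hle
    exact (hout z hz hle).not_ge (hmin (hball hθball))

theorem isMLE_iff {d : ℕ} {X : Type*} [Nonempty X] {t : X → EuclideanSpace ℝ (Fin d)}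
    {Θ : Set (EuclideanSpace ℝ (Fin d))}
    (hsum : ∀ φ ∈ Θ, Summable fun x => Real.exp ⟪φ, t x⟫) {x : X}
    {z : EuclideanSpace ℝ (Fin d)} :
    IsMLE t Θ x z ↔ z ∈ Θ ∧ IsMinOn (fun φ => logPartition t φ - ⟪φ, t x⟫) Θ z := by
  refine and_congr_right fun hz => forall₂_congr fun φ hφ => ?_
  rw [density_eq_exp (hsum φ hφ), density_eq_exp (hsum z hz), Real.exp_le_exp, Set.mem_ofPred_eq]
  constructor <;> intro h <;> linarith

section Limit

variable {d : ℕ} {ι : Type*} {X : ι → Type*} [∀ i, Nonempty (X i)]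
  {t : ∀ i, X i → EuclideanSpace ℝ (Fin d)} {Θ : Set (EuclideanSpace ℝ (Fin d))} {r : ι → ℝ}
  {a : EuclideanSpace ℝ (Fin d) → ℝ} {θ : EuclideanSpace ℝ (Fin d)}

/-- If `∇a(θ)` determines `θ`, the convex function `a - ⟪·, ∇a(θ)⟫` has its strict minimum at
`θ`. -/
theorem add_inner_gradient_lt (hΘ : IsOpen Θ) (hconv : ConvexOn ℝ Θ a)
    (hdiff : DifferentiableOn ℝ a Θ) (hθ : θ ∈ Θ)
    (hid : ∀ φ ∈ Θ, gradient a φ = gradient a θ → φ = θ) {y : EuclideanSpace ℝ (Fin d)}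
    (hy : y ∈ Θ) (hne : y ≠ θ) : a θ + ⟪gradient a θ, y - θ⟫ < a y := by
  have hle : ∀ x ∈ Θ, a θ + ⟪gradient a θ, x - θ⟫ ≤ a x := fun x hx =>
    add_inner_gradient_le hconv hθ hx (hdiff.differentiableAt (hΘ.mem_nhds hθ))
  refine (hle y hy).lt_of_ne fun heq => hne (hid y hy ?_)
  -- equality makes `y` another minimizer, so the gradients agree
  have hmin : IsLocalMin (fun x => a x - ⟪gradient a θ, x⟫) y := by
    filter_upwards [hΘ.mem_nhds hy] with x hx
    have := hle x hx
    rw [inner_sub_right] at this heq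
    linarith
  have hgrad : HasGradientAt (fun x => a x - ⟪gradient a θ, x⟫)
      (gradient a y - gradient a θ) y := by
    rw [hasGradientAt_iff_hasFDerivAt]
    refine ((hdiff.differentiableAt (hΘ.mem_nhds hy)).hasFDerivAt.sub
      (innerSL ℝ (gradient a θ)).hasFDerivAt).congr_fderiv ?_
    ext v
    simp
  exact sub_eq_zero.1 (gradient_eq_zero_of_isLocalMin hmin hgrad)

/-- When the normalized statistic is close to `∇a(θ)`, the normalized negative log-likelihood is
uniformly close to `a - ⟪·, ∇a(θ)⟫` near `θ`, hence larger on a small sphere around `θ` than at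
`θ`, and by convexity it is minimized inside that sphere only. -/
theorem eventually_norm_sub_lt_of_isMLE (hΘ : IsOpen Θ)
    (hsum : ∀ i, ∀ φ ∈ Θ, Summable fun x => Real.exp ⟪φ, t i x⟫)
    (hscale : ∀ φ ∈ Θ,
      Tendsto (fun i => logPartition (t i) φ / r i) (scaleLimit r) (𝓝 (a φ)))
    (hΘconv : Convex ℝ Θ) (hconv : ConvexOn ℝ Θ a) (hdiff : DifferentiableOn ℝ a Θ) (hθ : θ ∈ Θ)
    (hid : ∀ φ ∈ Θ, gradient a φ = gradient a θ → φ = θ) {ε : ℝ} (hε : 0 < ε) :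
    ∃ η > 0, ∀ᶠ i in scaleLimit r, ∀ x, ‖(r i)⁻¹ • t i x - gradient a θ‖ < η →
      (∃ z, IsMLE (t i) Θ x z) ∧ ∀ z, IsMLE (t i) Θ x z → ‖z - θ‖ < ε := by
  obtain ⟨ε₁, hε₁, hball₁⟩ := Metric.nhds_basis_closedBall.mem_iff.1 (hΘ.mem_nhds hθ)
  set δ := min ε ε₁ with hδ
  have hδ0 : 0 < δ := lt_min hε hε₁
  have hball : Metric.closedBall θ δ ⊆ Θ :=
    (Metric.closedBall_subset_closedBall (min_le_right _ _)).trans hball₁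
  set v := gradient a θ with hv
  have hFconv : ∀ i, ConvexOn ℝ Θ (logPartition (t i)) := fun i =>
    convexOn_logPartition.subset (fun φ hφ => hsum i φ hφ) hΘconv
  obtain ⟨γ, hγ0, hγ⟩ : ∃ γ > 0, ∀ y ∈ Metric.sphere θ δ, γ ≤ a y - a θ - ⟪v, y - θ⟫ := by
    refine (isCompact_sphere θ δ).exists_forall_le' (a := 0) ?_ fun y hy => ?_
    · have := hdiff.continuousOn.mono (Metric.sphere_subset_closedBall.trans hball)
      fun_prop
    · have hne : y ≠ θ := by
        rintro rfl
        rw [mem_sphere_iff_norm, sub_self, norm_zero] at hy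
        exact hδ0.ne hy
      have := add_inner_gradient_lt hΘ hconv hdiff hθ hid
        (hball (Metric.sphere_subset_closedBall hy)) hne
      linarith
  have hr := tendsto_scaleLimit (r := r)
  have hunif : TendstoUniformlyOn (fun i φ => logPartition (t i) φ / r i) a (scaleLimit r)
      (Metric.closedBall θ δ) := by
    have hloc := tendstoLocallyUniformlyOn_of_convexOn hΘ (l := scaleLimit r)
      (F := fun i φ => logPartition (t i) φ / r i) ?_ hscale hdiff.continuousOn
    · exact (tendstoLocallyUniformlyOn_iff_tendstoUniformlyOn_of_compact
        (isCompact_closedBall θ δ)).1 (hloc.mono hball)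
    · filter_upwards [hr.eventually_gt_atTop 0] with i hri
      simpa [div_eq_inv_mul] using (hFconv i).smul (inv_nonneg.2 hri.le)
  refine ⟨γ / (4 * δ), by positivity, ?_⟩
  filter_upwards [Metric.tendstoUniformlyOn_iff.1 hunif (γ / 4) (by positivity),
    hr.eventually_gt_atTop 0] with i hi hri x hx
  have hlin : ConcaveOn ℝ Θ fun φ => ⟪φ, t i x⟫ := by
    refine ⟨hΘconv, fun φ _ ψ _ α β _ _ _ => ?_⟩
    simp [inner_add_left, real_inner_smul_left]
  have hθball : θ ∈ Metric.closedBall θ δ := Metric.mem_closedBall_self hδ0.le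
  have hmain := exists_isMinOn_and_norm_sub_lt (f := fun φ => logPartition (t i) φ - ⟪φ, t i x⟫)
    ((hFconv i).sub hlin) (((hFconv i).continuousOn hΘ).sub (by fun_prop)) hδ0 hball ?_
  · simp only [isMLE_iff (hsum i)]
    exact ⟨hmain.1, fun z hz => (hmain.2 z hz.1 hz.2).trans_le (min_le_left _ _)⟩
  · intro y hy
    have h1 := hi y (Metric.sphere_subset_closedBall hy)
    have h2 := hi θ hθball
    rw [Real.dist_eq, abs_lt] at h1 h2
    have h3 := hγ y hy
    have h4 : ⟪y - θ, (r i)⁻¹ • t i x - v⟫ < γ / 4 := by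
      refine (real_inner_le_norm _ _).trans_lt ?_
      rw [mem_sphere_iff_norm.1 hy]
      calc δ * ‖(r i)⁻¹ • t i x - v‖ < δ * (γ / (4 * δ)) := by gcongr
        _ = γ / 4 := by field_simp
    rw [inner_sub_right, real_inner_comm v (y - θ), real_inner_smul_right] at h4
    have h5 : (r i)⁻¹ * ⟪y - θ, t i x⟫ <
        logPartition (t i) y / r i - logPartition (t i) θ / r i := by linarith
    rw [← sub_div, inv_mul_eq_div, div_lt_div_iff_of_pos_right hri, inner_sub_left] at h5
    linarith

end Limit

/-! ### The rate function and gradients -/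

/-- A point of finite rate is a limit of gradients `∇a(φ)` whose rate, which is
`⟪φ - θ, ∇a(φ)⟫ - (a(φ) - a(θ))`, is no larger. -/
theorem exists_gradient_mem_nhds {d : ℕ} {Θ : Set (EuclideanSpace ℝ (Fin d))} (hΘ : IsOpen Θ)
    {a : EuclideanSpace ℝ (Fin d) → ℝ} (hconv : ConvexOn ℝ Θ a)
    (hdiff : DifferentiableOn ℝ a Θ) (hsteep : IsSteep Θ a) {θ s : EuclideanSpace ℝ (Fin d)}
    (hθ : θ ∈ Θ) {K : Set (EuclideanSpace ℝ (Fin d))} (hK : K ∈ 𝓝 s) {j : ℝ}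
    (hj : rate Θ a θ s ≤ j) :
    ∃ φ ∈ Θ, K ∈ 𝓝 (gradient a φ) ∧ ⟪φ - θ, gradient a φ⟫ - (a φ - a θ) ≤ j := by
  have hj' : ∀ φ ∈ Θ, ⟪φ - θ, s⟫ - (a φ - a θ) ≤ j := by
    intro φ hφ
    have hle : ((⟪φ - θ, s⟫ - (a (θ + (φ - θ)) - a θ) : ℝ) : EReal) ≤ j :=
      (le_iSup₂ (f := fun ψ (_ : θ + ψ ∈ Θ) => ((⟪ψ, s⟫ - (a (θ + ψ) - a θ) : ℝ) : EReal))
        (φ - θ) (by rwa [add_sub_cancel])).trans hj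
    rw [add_sub_cancel] at hle
    exact EReal.coe_le_coe_iff.1 hle
  have hj0 : 0 ≤ j := by simpa using hj' θ hθ
  obtain ⟨ρ, hρ, hball⟩ := Metric.mem_nhds_iff.1 hK
  -- the penalty displaces the gradient from `s` by at most `√(2 δ j)`
  set δ := ρ ^ 2 / (4 * (j + 1)) with hδ
  have hδ0 : 0 < δ := by positivity
  obtain ⟨φ, hφ, hgrad, hle⟩ := exists_gradient_eq hΘ hconv hdiff hsteep hθ hδ0 hj'
  refine ⟨φ, hφ, ?_, ?_⟩
  · refine mem_of_superset (Metric.isOpen_ball.mem_nhds ?_) hball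
    rw [mem_ball_iff_norm, hgrad, sub_sub_cancel_left, norm_neg, norm_smul,
      Real.norm_of_nonneg hδ0.le]
    refine lt_of_pow_lt_pow_left₀ 2 hρ.le ?_
    have h1 : (δ * ‖φ - θ‖) ^ 2 = 2 * δ * (δ / 2 * ‖φ - θ‖ ^ 2) := by ring
    have h2 : 2 * δ * (j + 1) = ρ ^ 2 / 2 := by rw [hδ]; field_simp; ring
    have h3 : 2 * δ * (δ / 2 * ‖φ - θ‖ ^ 2) ≤ 2 * δ * (j + 1) := by gcongr; linarith
    have h4 : 0 < ρ ^ 2 := by positivity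
    linarith
  · rw [hgrad, inner_sub_right, real_inner_smul_right, real_inner_self_eq_norm_sq]
    have h1 := hj' φ hφ
    have h2 : 0 ≤ δ * ‖φ - θ‖ ^ 2 := by positivity
    linarith

end ExpFam

/-! ### Large deviations and consistency -/

theorem theorem4 {d : ℕ} {I : Type*} (𝒜 : Set (Finset I))
    (X : 𝒜 → Type*) [∀ A, Countable (X A)] [∀ A, Nonempty (X A)]
    [∀ A, MeasurableSpace (X A)] [∀ A, MeasurableSingletonClass (X A)]
    (t : ∀ A : 𝒜, X A → EuclideanSpace ℝ (Fin d))
    (Θ : Set (EuclideanSpace ℝ (Fin d))) (hΘ : IsOpen Θ)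
    (hsum : ∀ A, ∀ θ' ∈ Θ, Summable fun x : X A => Real.exp ⟪θ', t A x⟫)
    (r : 𝒜 → ℝ) (a : EuclideanSpace ℝ (Fin d) → ℝ)
    (hscale : ∀ θ' ∈ Θ,
      Tendsto (fun A => ExpFam.logPartition (t A) θ' / r A) (ExpFam.scaleLimit r) (𝓝 (a θ')))
    (hdiff : DifferentiableOn ℝ a Θ) (hsteep : ExpFam.IsSteep Θ a)
    (θ : EuclideanSpace ℝ (Fin d)) (hθ : θ ∈ Θ) :
    (∀ K : Set (EuclideanSpace ℝ (Fin d)),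
      -(⨅ s ∈ interior K, ExpFam.rate Θ a θ s) ≤
          liminf (fun A => ExpFam.scaledLog (r A)
            (ExpFam.law (t A) θ {x | (r A)⁻¹ • t A x ∈ K})) (ExpFam.scaleLimit r) ∧
        limsup (fun A => ExpFam.scaledLog (r A)
            (ExpFam.law (t A) θ {x | (r A)⁻¹ • t A x ∈ K})) (ExpFam.scaleLimit r) ≤
          -(⨅ s ∈ closure K, ExpFam.rate Θ a θ s)) ∧
    (∀ ε : ℝ, 0 < ε →
      Tendsto (fun A => ExpFam.law (t A) θ {x | ε ≤ ‖(r A)⁻¹ • t A x - gradient a θ‖})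
        (ExpFam.scaleLimit r) (𝓝 0)) ∧
    ((∀ θ' ∈ Θ, gradient a θ' = gradient a θ → θ' = θ) →
      ∀ ε : ℝ, 0 < ε →
        Tendsto (fun A => ExpFam.law (t A) θ
            {x | (∃ θhat, ExpFam.IsMLE (t A) Θ x θhat) ∧
              ∀ θhat, ExpFam.IsMLE (t A) Θ x θhat → ‖θhat - θ‖ < ε})
          (ExpFam.scaleLimit r) (𝓝 1)) := by
  rcases (ExpFam.scaleLimit r).eq_or_neBot with hbot | hne
  · -- the limit `r → ∞` is void when `r` is bounded above
    rw [hbot]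
    simp
  have hr := ExpFam.tendsto_scaleLimit (r := r)
  have hpos : ∀ᶠ A in ExpFam.scaleLimit r, 0 < r A := hr.eventually_gt_atTop 0
  have hscaled : ∀ C : Set (EuclideanSpace ℝ (Fin d)), Convex ℝ C →
      (∀ A, C ⊆ {φ | Summable fun x => Real.exp ⟪φ, t A x⟫}) →
      ∀ᶠ A in ExpFam.scaleLimit r,
        ConvexOn ℝ C fun φ => ExpFam.logPartition (t A) φ / r A := by
    intro C hC hsub
    filter_upwards [hpos] with A hA
    simpa [div_eq_inv_mul] using
      (ExpFam.convexOn_logPartition.subset (hsub A) hC).smul (inv_nonneg.2 hA.le)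
  have hΘconv : Convex ℝ Θ := ExpFam.convex_of_steep hΘ
    (hscaled _ (convex_convexHull ℝ Θ) fun A =>
      convexHull_min (fun φ hφ => hsum A φ hφ) ExpFam.convexOn_logPartition.1) hscale hsteep
  have hconv : ConvexOn ℝ Θ a := by
    refine ⟨hΘconv, fun x hx y hy α β hα hβ hαβ => ?_⟩
    refine le_of_tendsto_of_tendsto (hscale _ (hΘconv hx hy hα hβ hαβ))
      (((hscale x hx).const_mul α).add ((hscale y hy).const_mul β)) ?_
    filter_upwards [hscaled Θ hΘconv fun A φ hφ => hsum A φ hφ] with A hA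
    exact hA.2 hx hy hα hβ hαβ
  have hdiffAt : ∀ φ ∈ Θ, DifferentiableAt ℝ a φ := fun φ hφ =>
    hdiff.differentiableAt (hΘ.mem_nhds hφ)
  have hwlln : ∀ ε : ℝ, 0 < ε →
      Tendsto (fun A => ExpFam.law (t A) θ {x | ε ≤ ‖(r A)⁻¹ • t A x - gradient a θ‖})
        (ExpFam.scaleLimit r) (𝓝 0) := fun ε hε =>
    ExpFam.tendsto_law_norm_sub_gradient hΘ hsum hscale hθ (hdiffAt θ hθ) hε
  refine ⟨fun K => ⟨?_, ?_⟩, hwlln, fun hid ε hε => ?_⟩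
  · rw [EReal.neg_le]
    refine le_iInf₂ fun s hs => ?_
    rw [EReal.neg_le]
    refine EReal.ge_of_forall_gt_iff_ge.1 fun c hc => ?_
    rw [EReal.lt_neg_comm, EReal.lt_iff_exists_real_btwn] at hc
    obtain ⟨j, hj, hjc⟩ := hc
    rw [← EReal.coe_neg, EReal.coe_lt_coe_iff] at hjc
    obtain ⟨φ, hφ, hKφ, hle⟩ := ExpFam.exists_gradient_mem_nhds hΘ hconv hdiff hsteep hθ
      (mem_interior_iff_mem_nhds.1 hs) hj.le
    refine le_liminf_of_le isCobounded_ge_of_top ?_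
    filter_upwards [hpos, ExpFam.eventually_le_law hΘ hsum hscale hθ hφ (hdiffAt φ hφ) hKφ
      (c := c) (by linarith)] with A hA hlaw
    exact (ExpFam.scaledLog_ofReal_exp hA).ge.trans (ExpFam.scaledLog_mono hA hlaw)
  · rw [EReal.le_neg]
    refine EReal.ge_of_forall_gt_iff_ge.1 fun c hc => ?_
    rw [EReal.le_neg, ← EReal.coe_neg]
    obtain ⟨c', hcc', hc'⟩ := EReal.lt_iff_exists_real_btwn.1 hc
    refine limsup_le_of_le isCobounded_le_of_bot ?_
    filter_upwards [hpos, ExpFam.eventually_law_le hΘ hsum hscale hθ isClosed_closure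
      (fun s hs => hc'.trans_le (iInf₂_le s hs)) (EReal.coe_lt_coe_iff.1 hcc')] with A hA hlaw
    refine le_trans (ExpFam.scaledLog_mono hA ?_) (ExpFam.scaledLog_ofReal_exp hA).le
    refine le_trans (measure_mono fun x hx => ?_) hlaw
    exact subset_closure (s := K) hx
  · obtain ⟨η, hη, hev⟩ := ExpFam.eventually_norm_sub_lt_of_isMLE hΘ hsum hscale hΘconv hconv
      hdiff hθ hid hε
    have hlim : Tendsto (fun A => 1 - ExpFam.law (t A) θ
        {x | η ≤ ‖(r A)⁻¹ • t A x - gradient a θ‖}) (ExpFam.scaleLimit r) (𝓝 1) := by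
      simpa using ENNReal.Tendsto.sub tendsto_const_nhds (hwlln η hη) (Or.inl ENNReal.one_ne_top)
    have hP := fun A => ExpFam.isProbabilityMeasure_law (hsum A θ hθ)
    refine tendsto_of_tendsto_of_tendsto_of_le_of_le' hlim tendsto_const_nhds ?_
      (Eventually.of_forall fun A => prob_le_one)
    filter_upwards [hev] with A hA
    rw [← prob_compl_eq_one_sub (Set.to_countable _).measurableSet]
    exact measure_mono fun x hx => hA x (not_le.1 hx)
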